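/- **Setting (private function retrieval, PFR).** Let $p$ be a prime, $F\ge 1$, and let $GF(q)$ be a subfield of $GF(p^F)$. Each of $N$ non-colluding servers stores the same database of $K\ge 1$ messages $W_1,\dots,W_K$, where $W_k=(W_k[1],\dots,W_k[L])$ and all symbols $W_k[t]$ are independent and uniform in $GF(p^F)$; write $\mathbf W[t]=(W_1[t],\dots,W_K[t])^T$. Let $v(1),\dots,v(\tilde K)$, with $\tilde K=\frac{q^K-1}{q-1}$, be representatives of the classes of parallel vectors in $GF(q)^K\setminus\{0\}$. An $(L,Q)$ PFR scheme consists of - for each $\theta\in\{1,\dots,\tilde K\}$, discrete random queries $Q^{(1)}_\theta,\dots,Q^{(N)}_\theta$, one per server, jointly independent of the database; - for each server $n$, an answer $A^{(n)}_\theta$, which is a string of $p$-ary symbols, computed by a function of the received query and the database, and whose length is determined by the query, such that the largest possible total length $\sum_n|A^{(n)}_\theta|$, over all $\theta$ and all queries that occur with positive probability, equals $QF$; - for each $\theta$, a decoding function that maps all the queries and answers to an estimate of $(v(\theta)^T\mathbf W[t])_{t=1}^L$; such that for each single server $n$ the joint law of $(Q^{(n)}_\theta,A^{(n)}_\theta,\mathbf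 W[1],\dots,\mathbf W[L])$ does not depend on $\theta$. Its rate is $L/Q$ and its error probability is the maximum over $\theta$ of the probability that the estimate is wrong. A rate $R$ is achievable if there is a sequence of $(L,Q)$ PFR schemes with $L\to\infty$, rates tending to $R$, and error probabilities tending to $0$. The capacity $C$ is the supremum of the achievable rates. **Statement.** For all $N\ge1$ the set of achievable rates is nonempty and bounded above, and, as the number of servers $N\to\infty$ with $K$ fixed, the capacity $C=C_{N,K}$ is asymptotically equal to $1-\frac1N$, uniformly in $p$, $F$ and $q$. Precisely, $$\frac{C_{N,K}}{1-\frac1N}\longrightarrow 1\quad (K\ge 1),\qquad\text{and}\qquad C_{N,K}=1-\frac1N+o\!\left(\frac1N\right)\quad (K\ge 2).$$ -/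

import Mathlib

open Filter Topology
open scoped ENNReal

noncomputable section

namespace PFR

/-- A database: `K` files, each made of `L` segments in `GF(p^F)`; the `k`-th symbol of layer `t`
is `w t k`. -/
abbrev Database (p : ℕ) [Fact p.Prime] (F K L : ℕ) : Type :=
  Fin L → Fin K → GaloisField p F

instance instFintypeDatabase (p : ℕ) [Fact p.Prime] (F K L : ℕ) :
    Fintype (Database p F K L) := Fintype.ofFinite _

/-- The index set of the possible requests: nonzero vectors in `S ^ K` up to parallelism, where
`S = GF(q)` is a subfield of `GF(p^F)`.  The coefficient vector `v(θ)` is `θ.rep`. -/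
abbrev Index {p : ℕ} [Fact p.Prime] {F : ℕ} (S : Subfield (GaloisField p F)) (K : ℕ) : Type :=
  Projectivization S (Fin K → S)

/-- The requested function of the database: the values `v(θ)ᵀ W[t]`, for `t` in `Fin L`. -/
def target {p : ℕ} [Fact p.Prime] {F : ℕ} {S : Subfield (GaloisField p F)} {K L : ℕ}
    (θ : Index S K) (w : Database p F K L) : Fin L → GaloisField p F :=
  fun t => ∑ k, (θ.rep k : GaloisField p F) * w t k

/-- Joint law of the queries and the database: the queries have law `μ`, and the database is
uniform and independent of the queries. -/
def jointLaw {p : ℕ} [Fact p.Prime] {F N K L : ℕ} {Query : Type} (μ : PMF (Fin N → Query)) :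
    PMF ((Fin N → Query) × Database p F K L) :=
  μ.bind fun x => (PMF.uniformOfFintype (Database p F K L)).map fun w => (x, w)

/-- An `(L, Q)` PFR scheme for `N` servers and `K` files with segments in `GF(p^F)`, for linear
combinations with coefficients in the subfield `S`. -/
structure Scheme (p : ℕ) [Fact p.Prime] (F : ℕ) (S : Subfield (GaloisField p F))
    (N K L Q : ℕ) where
  /-- the alphabet of the queries -/
  Query : Type
  /-- the joint law of the `N` queries when `v(θ)` is requested -/
  queryLaw : Index S K → PMF (Fin N → Query)
  /-- the answer of a server: a string of `p`-ary symbols, computed from the query that the server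
  received and from the database -/
  ans : Fin N → Query → Database p F K L → List (ZMod p)
  /-- the number of `p`-ary symbols that a query asks for -/
  ansLen : Fin N → Query → ℕ
  length_ans : ∀ n x w, (ans n x w).length = ansLen n x
  /-- the decoding functions, one for each request -/
  dec : Index S K → (Fin N → Query) → (Fin N → List (ZMod p)) → Fin L → GaloisField p F
  /-- the largest total length of the answers is `Q * F` (in `p`-ary units) -/
  cost : IsGreatest {d : ℕ | ∃ θ, ∃ x ∈ (queryLaw θ).support, d = ∑ n, ansLen n (x n)} (Q * F)
  /-- privacy: for each single server, the joint law of its query, its answer and the database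
  does not depend on the request -/
  privacy : ∀ (n : Fin N) (θ θ' : Index S K),
    (jointLaw (queryLaw θ)).map (fun z => (z.1 n, ans n (z.1 n) z.2, z.2)) =
      (jointLaw (queryLaw θ')).map (fun z => (z.1 n, ans n (z.1 n) z.2, z.2))

/-- The probability of error: the maximum over the requests `θ` of the probability that the
decoded value differs from the requested one. -/
def Scheme.errorProb {p : ℕ} [Fact p.Prime] {F : ℕ} {S : Subfield (GaloisField p F)}
    {N K L Q : ℕ} (s : Scheme p F S N K L Q) : ℝ≥0∞ :=
  ⨆ θ : Index S K, (jointLaw (s.queryLaw θ)).toOuterMeasure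
    {z : (Fin N → s.Query) × Database p F K L |
      s.dec θ z.1 (fun n => s.ans n (z.1 n) z.2) ≠ target θ z.2}

/-- `R` is achievable if there is a sequence of `(L, Q)` schemes with `L → ∞` whose rates `L / Q`
tend to `R` and whose error probabilities tend to `0`. -/
def Achievable (p : ℕ) [Fact p.Prime] (F : ℕ) (S : Subfield (GaloisField p F)) (N K : ℕ)
    (R : ℝ) : Prop :=
  ∃ (L Q : ℕ → ℕ) (s : ∀ j, Scheme p F S N K (L j) (Q j)),
    Tendsto L atTop atTop ∧
    Tendsto (fun j => (L j : ℝ) / (Q j : ℝ)) atTop (𝓝 R) ∧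
    Tendsto (fun j => (s j).errorProb) atTop (𝓝 0)

/-- The capacity: the supremum of the achievable rates. -/
def capacity (p : ℕ) [Fact p.Prime] (F : ℕ) (S : Subfield (GaloisField p F)) (N K : ℕ) : ℝ :=
  sSup {R : ℝ | Achievable p F S N K R}

end PFR

end

open Filter Topology
open scoped ENNReal

noncomputable section

namespace PFR

/-! ### Entropy inequalities by counting on a finite uniform space. -/

section Counting

open Finset Classical

variable {Ω ξ υ ι β : Type*} [Fintype Ω]

/-! The capacity is squeezed between `1 - 1/N` and `N/(N+1)` when `K ≥ 2`; these differ by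
`1/(N(N+1))`, which is `o(1/N)`. For `K = 1` the upper bound is just `1`. Neither bound involves the
fields, hence the uniformity.

Lower bound (`achievable_sub_one_div`): one server gets uniform coefficients, and each other server
gets them shifted by `v(θ)` in a block of its own. Every marginal is uniform, and subtracting the
first answer from another yields one block of the requested values, so `N` answers give `N - 1`
useful ones.

Upper bound: only requests for single files matter. Measure entropy in symbols of `GF(p^F)` and
neglect errors. When file `i` is requested, the answers determine `W_i`, so `L + H(A_n | W_i) ≤ Q`
for every server `n` (`log_card_add_condEntropy_le`). When another file `j` is requested, the
answers determine `W_j`, which is independent of `W_i`, so subadditivity gives `L ≤ ∑ H(A_n | W_i)`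
(`log_card_le_sum_condEntropy`). By privacy the average of `H(A_n | W_i)` over the queries is the
same for both requests (`tsum_condEntropy`). Summing the first bound over `n` gives `(N + 1) L ≤ N
Q`.

Entropies are sums of logarithms of fiber sizes, for fixed queries. Errors are handled by putting
Fano's correction into the weights of Gibbs' inequality. -/

/-- The number of points with the property `P`. -/
def count (P : Ω → Prop) : ℕ := #{ω | P ω}

/-- The number of points on which `f` takes the same value as at `ω`. -/
def fiberCard (f : Ω → β) (ω : Ω) : ℕ := #{ω' | f ω' = f ω}

lemma fiberCard_pos (f : Ω → β) (ω : Ω) : 0 < fiberCard f ω :=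
  card_pos.2 ⟨ω, by simp⟩

lemma fiberCard_prodMk_le (f : Ω → β) (g : Ω → ξ) (ω : Ω) :
    fiberCard (fun ω => (f ω, g ω)) ω ≤ count fun ω' => g ω' = g ω := by
  refine card_le_card fun ω' h => ?_
  simp only [mem_filter, mem_univ, true_and, Prod.mk.injEq] at h ⊢
  exact h.2

/-- Gibbs' inequality, for the uniform distribution. -/
lemma sum_log_nonpos_of_sum_le (g : Ω → ℝ) (hg : ∀ ω, 0 < g ω)
    (h : ∑ ω, g ω ≤ Fintype.card Ω) : ∑ ω, Real.log (g ω) ≤ 0 := by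
  calc ∑ ω, Real.log (g ω) ≤ ∑ ω, (g ω - 1) :=
        sum_le_sum fun ω _ => Real.log_le_sub_one_of_pos (hg ω)
    _ ≤ 0 := by simpa [sum_sub_distrib] using h

/-- Each value of `f` on `G` contributes at most 1, because its points in `G` are among the points
of the whole fiber. -/
lemma sum_inv_fiberCard_le (f : Ω → β) (G : Finset Ω) :
    ∑ ω ∈ G, (fiberCard f ω : ℝ)⁻¹ ≤ #(G.image f) := by
  rw [← sum_fiberwise_of_maps_to (fun ω hω => mem_image_of_mem f hω), card_eq_sum_ones,
    Nat.cast_sum]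
  refine sum_le_sum fun b hb => ?_
  obtain ⟨ω₀, -, rfl⟩ := mem_image.1 hb
  have : ∀ ω ∈ G.filter (fun ω => f ω = f ω₀),
      (fiberCard f ω : ℝ)⁻¹ = (fiberCard f ω₀ : ℝ)⁻¹ := by
    intro ω hω
    simp only [fiberCard, (mem_filter.1 hω).2]
  rw [sum_congr rfl this, sum_const, nsmul_eq_mul]
  have h0 : (0 : ℝ) < fiberCard f ω₀ := by exact_mod_cast fiberCard_pos f ω₀
  rw [← div_eq_mul_inv, Nat.cast_one, div_le_one h0]
  exact_mod_cast card_le_card (filter_subset_filter _ (subset_univ G))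

/-- If `X` can be decoded from `A`, up to some errors, and `A` takes at most `B` values, then the
entropy of `(A i, X)` is at most `log B`, up to Fano's correction. -/
lemma sum_log_card_div_fiberCard_le [Nonempty Ω] [Fintype ξ] (A : Ω → ι → β) (X : Ω → ξ)
    (d : (ι → β) → ξ) (B : ℕ) (T : Finset (ι → β)) (hT : ∀ ω, A ω ∈ T) (hTB : #T ≤ B) (i : ι) :
    ∑ ω, Real.log (Fintype.card Ω / fiberCard (fun ω => (A ω i, X ω)) ω) ≤
      Fintype.card Ω * Real.log (2 * B) +
        count (fun ω => d (A ω) ≠ X ω) * Real.log (Fintype.card ξ) := by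
  simp only [count]
  have hB : #(univ.image A) ≤ B :=
    (card_le_card (image_subset_iff.2 fun ω _ => hT ω)).trans hTB
  set f : Ω → β × ξ := fun ω => (A ω i, X ω) with hf
  set O : ℝ := (Fintype.card Ω : ℝ) with hO
  set M : ℝ := (Fintype.card ξ : ℝ) with hM
  have hO0 : 0 < O := by rw [hO]; exact_mod_cast Fintype.card_pos
  have hne : Nonempty ξ := ⟨X (Classical.arbitrary Ω)⟩
  have hM0 : 0 < M := by rw [hM]; exact_mod_cast Fintype.card_pos
  have hBpos : 0 < B := lt_of_lt_of_le (card_pos.2 (univ_nonempty.image A)) hB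
  have hB0 : (0 : ℝ) < B := by exact_mod_cast hBpos
  have hN (ω : Ω) : (0 : ℝ) < fiberCard f ω := by exact_mod_cast fiberCard_pos f ω
  -- The reference weight `1 / (2 * B * c ω)` gives mass at most 1/2 to the at most `B` pairs `(a i,
  -- d a)` of correct decodings, and at most 1/2 to the at most `B * M` pairs that errors can
  -- produce.
  let c : Ω → ℝ := fun ω => if d (A ω) ≠ X ω then M else 1
  have hc (ω : Ω) : 0 < c ω := by simp only [c]; split_ifs <;> first | exact hM0 | norm_num
  have key := sum_log_nonpos_of_sum_le (fun ω => O / fiberCard f ω / (2 * B * c ω))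
    (fun ω => by have := hN ω; have := hc ω; positivity) ?_
  · have e (ω : Ω) : Real.log (O / fiberCard f ω / (2 * B * c ω)) =
        Real.log (O / fiberCard f ω) -
          (Real.log (2 * B) + if d (A ω) ≠ X ω then Real.log M else 0) := by
      have := hN ω
      have := hc ω
      rw [Real.log_div (by positivity) (by positivity), Real.log_mul (by positivity) (by positivity)]
      congr 2
      simp only [c]; split_ifs <;> simp
    simp only [e, sum_sub_distrib, sum_add_distrib, ← sum_filter, sum_const, nsmul_eq_mul,
      card_univ] at key
    linarith
  · have hgood : ∑ ω with d (A ω) = X ω, (fiberCard f ω : ℝ)⁻¹ ≤ B := by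
      refine (sum_inv_fiberCard_le f _).trans ?_
      have : ({ω | d (A ω) = X ω} : Finset Ω).image f ⊆
          (univ.image A).image fun a => (a i, d a) := by
        intro b hb
        obtain ⟨ω, hω, rfl⟩ := mem_image.1 hb
        rw [image_image]
        exact mem_image.2 ⟨ω, mem_univ _, by simp [hf, (mem_filter.1 hω).2]⟩
      refine Nat.cast_le.2 ?_
      convert (card_le_card this).trans (card_image_le.trans hB)
      rfl
    have hbad : ∑ ω with ¬ d (A ω) = X ω, (fiberCard f ω : ℝ)⁻¹ ≤ B * M := by
      refine (sum_inv_fiberCard_le f _).trans ?_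
      have : ({ω | ¬ d (A ω) = X ω} : Finset Ω).image f ⊆
          ((univ.image A).image fun a => a i) ×ˢ univ := by
        intro b hb
        obtain ⟨ω, -, rfl⟩ := mem_image.1 hb
        rw [image_image]
        exact mem_product.2 ⟨mem_image.2 ⟨ω, mem_univ _, rfl⟩, mem_univ _⟩
      have h2 := (card_le_card this).trans (card_product _ _).le
      rw [hM, ← card_univ, ← Nat.cast_mul]
      refine Nat.cast_le.2 ?_
      convert h2.trans (Nat.mul_le_mul_right _ (card_image_le.trans hB))
      rfl
    rw [← sum_filter_add_sum_filter_not univ (fun ω => d (A ω) = X ω)]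
    have e1 : ∑ ω with d (A ω) = X ω, O / fiberCard f ω / (2 * B * c ω) =
        O / (2 * B) * ∑ ω with d (A ω) = X ω, (fiberCard f ω : ℝ)⁻¹ := by
      rw [mul_sum]
      refine sum_congr rfl fun ω hω => ?_
      have := hN ω
      simp only [c, (mem_filter.1 hω).2]
      simp
      field_simp
    have e2 : ∑ ω with ¬ d (A ω) = X ω, O / fiberCard f ω / (2 * B * c ω) =
        O / (2 * B * M) * ∑ ω with ¬ d (A ω) = X ω, (fiberCard f ω : ℝ)⁻¹ := by
      rw [mul_sum]
      refine sum_congr rfl fun ω hω => ?_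
      have := hN ω
      simp only [c, ne_eq, (mem_filter.1 hω).2, not_false_iff, if_true]
      field_simp
    rw [e1, e2]
    calc _ ≤ O / (2 * B) * B + O / (2 * B * M) * (B * M) := by gcongr
      _ = O := by field_simp; norm_num

/-- If `Y` can be decoded from `A`, up to some errors, where `X` and `Y` are independent and
uniform, then the entropies of the coordinates of `A`, conditioned on `X`, add up to at least the
entropy of `Y`, up to Fano's correction. -/
lemma card_mul_log_le_sum_sum_log_div_fiberCard [Nonempty Ω] [Fintype ξ] [Fintype υ] [Fintype ι]
    (A : Ω → ι → β)
    (X : Ω → ξ) (Y : Ω → υ) (d : (ι → β) → υ) (c : ℕ) (hX : ∀ x, count (fun ω => X ω = x) = c)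
    (hXY : ∀ x y, count (fun ω => X ω = x ∧ Y ω = y) * Fintype.card υ ≤ c) :
    Fintype.card Ω * Real.log (Fintype.card υ) ≤
      Fintype.card Ω * Real.log 2 + count (fun ω => d (A ω) ≠ Y ω) * Real.log (Fintype.card υ) +
      ∑ ω, ∑ i, Real.log (c / fiberCard (fun ω => (A ω i, X ω)) ω) := by
  simp only [count] at hX hXY ⊢
  set O : ℝ := (Fintype.card Ω : ℝ) with hO
  set M : ℝ := (Fintype.card υ : ℝ) with hM
  have hne : Nonempty υ := ⟨Y (Classical.arbitrary Ω)⟩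
  have hM0 : 0 < M := by rw [hM]; exact_mod_cast Fintype.card_pos
  let N : Ω → ι → ℝ := fun ω i => fiberCard (fun ω => (A ω i, X ω)) ω
  have hN (ω : Ω) (i : ι) : 0 < N ω i := by
    simp only [N]; exact_mod_cast fiberCard_pos _ ω
  have hc0 : (0 : ℝ) < c := by
    have ω₀ := Classical.arbitrary Ω
    have : 0 < c := by rw [← hX (X ω₀)]; exact card_pos.2 ⟨ω₀, by simp⟩
    exact_mod_cast this
  have hNc (ω : Ω) (i : ι) : N ω i / c ≤ 1 := by
    rw [div_le_one hc0]
    simp only [N]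
    have := fiberCard_prodMk_le (fun ω => A ω i) X ω
    rw [count, hX] at this
    exact_mod_cast this
  let m : Ω → ℝ := fun ω => if d (A ω) ≠ Y ω then M else 1
  have hm (ω : Ω) : 0 < m ω := by simp only [m]; split_ifs <;> first | exact hM0 | norm_num
  -- Gibbs against the product of the conditional marginals given `X`: this is subadditivity of
  -- conditional entropy. Correct and wrong decodings each account for at most `O / 2` of the sum.
  have key := sum_log_nonpos_of_sum_le (fun ω => M / (2 * m ω) * ∏ i, (N ω i / c))
    (fun ω => by
      have := hm ω
      have : 0 < ∏ i, (N ω i / c) := prod_pos fun i _ => div_pos (hN ω i) hc0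
      positivity) ?_
  · have e (ω : Ω) : Real.log (M / (2 * m ω) * ∏ i, (N ω i / c)) =
        Real.log M - (Real.log 2 + (if d (A ω) ≠ Y ω then Real.log M else 0)) -
          ∑ i, Real.log (c / N ω i) := by
      have := hm ω
      have hp : 0 < ∏ i, (N ω i / c) := prod_pos fun i _ => div_pos (hN ω i) hc0
      rw [Real.log_mul (by positivity) hp.ne', Real.log_div (by positivity) (by positivity),
        Real.log_mul (by positivity) (by positivity),
        Real.log_prod (fun i _ => (div_pos (hN ω i) hc0).ne')]
      have h1 : Real.log (m ω) = if d (A ω) ≠ Y ω then Real.log M else 0 := by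
        simp only [m]; split_ifs <;> simp
      have h2 : ∑ i, Real.log (N ω i / c) = - ∑ i, Real.log (c / N ω i) := by
        rw [← sum_neg_distrib]
        exact sum_congr rfl fun i _ => by rw [← Real.log_inv, inv_div]
      rw [h1, h2]; ring
    simp only [e, sum_sub_distrib, sum_add_distrib, ← sum_filter, sum_const, nsmul_eq_mul,
      card_univ] at key
    simp only [N] at key
    linarith
  · have hgood : ∑ ω with d (A ω) = Y ω, ∏ i, (N ω i / c) ≤ O / M := by
      let T : Finset (ι → β) := Fintype.piFinset fun i => univ.image fun ω => A ω i
      let P : ξ → (ι → β) → ℝ := fun x a => ∏ i, ((#{ω | A ω i = a i ∧ X ω = x} : ℝ) / c)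
      have hP (x : ξ) : ∑ a ∈ T, P x a = 1 := by
        simp only [T, P]
        rw [← prod_univ_sum (fun i => univ.image fun ω => A ω i)
          (fun i b => (#{ω | A ω i = b ∧ X ω = x} : ℝ) / c)]
        refine prod_eq_one fun i _ => ?_
        rw [← sum_div, div_eq_one_iff_eq hc0.ne', ← hX x]
        rw [card_eq_sum_card_fiberwise (f := fun ω => A ω i) (t := univ.image fun ω => A ω i)
          (fun ω _ => mem_coe.2 (mem_image_of_mem _ (mem_univ _)))]
        push_cast
        refine sum_congr rfl fun b _ => ?_
        rw [filter_filter]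
        congr 2
        ext ω; simp [and_comm]
      have hPN (ω : Ω) : ∏ i, (N ω i / c) = P (X ω) (A ω) := by
        simp only [N, P, fiberCard, Prod.mk.injEq]
      have hP0 (x a) : 0 ≤ P x a := prod_nonneg fun i _ => by positivity
      -- Under correct decoding `A ω = a` forces `Y ω = d a`, so independence of `X` and `Y` saves a
      -- factor `M`.
      have hcount (x : ξ) (a : ι → β) :
          (#{ω | d (A ω) = Y ω ∧ X ω = x ∧ A ω = a} : ℝ) ≤ c / M := by
        rw [le_div_iff₀ hM0, hM]
        refine le_trans ?_ (Nat.cast_le.2 (hXY x (d a)))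
        push_cast
        refine mul_le_mul_of_nonneg_right (Nat.cast_le.2 (card_le_card fun ω hω => ?_)) hM0.le
        simp only [mem_filter, mem_univ, true_and] at hω ⊢
        obtain ⟨h₁, h₂, h₃⟩ := hω
        exact ⟨h₂, by rw [← h₁, h₃]⟩
      have hOc : O = Fintype.card ξ * c := by
        rw [hO, ← card_univ, card_eq_sum_card_fiberwise (f := X) (t := univ)
          (fun ω _ => mem_coe.2 (mem_univ _))]
        simp [hX]
      calc ∑ ω with d (A ω) = Y ω, ∏ i, (N ω i / c)
          = ∑ ω with d (A ω) = Y ω, P (X ω) (A ω) := sum_congr rfl fun ω _ => hPN ω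
        _ = ∑ z ∈ univ ×ˢ T, ∑ ω with d (A ω) = Y ω ∧ (X ω, A ω) = z, P z.1 z.2 := by
            rw [← sum_fiberwise_of_maps_to (t := univ ×ˢ T) (g := fun ω => (X ω, A ω))
              (fun ω _ => mem_product.2 ⟨mem_univ _, Fintype.mem_piFinset.2 fun i =>
                mem_image_of_mem (fun ω => A ω i) (mem_univ ω)⟩)]
            refine sum_congr rfl fun z _ => ?_
            rw [filter_filter]
            refine sum_congr rfl fun ω hω => ?_
            rw [← (mem_filter.1 hω).2.2]
        _ ≤ ∑ z ∈ univ ×ˢ T, c / M * P z.1 z.2 := by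
            refine sum_le_sum fun z _ => ?_
            rw [sum_const, nsmul_eq_mul]
            refine mul_le_mul_of_nonneg_right ?_ (hP0 _ _)
            simpa [Prod.ext_iff] using hcount z.1 z.2
        _ = O / M := by
            rw [sum_product]
            simp only [← mul_sum, hP]
            simp [hOc]; ring
    have hbad : ∑ ω with ¬ d (A ω) = Y ω, ∏ i, (N ω i / c) ≤ O := by
      calc _ ≤ ∑ ω with ¬ d (A ω) = Y ω, (1 : ℝ) :=
            sum_le_sum fun ω _ => prod_le_one (fun i _ => div_nonneg (hN ω i).le hc0.le)
              fun i _ => hNc ω i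
        _ ≤ O := by
            rw [sum_const, nsmul_eq_mul, mul_one, hO, ← card_univ]
            exact_mod_cast card_le_card (filter_subset _ _)
    rw [← sum_filter_add_sum_filter_not univ (fun ω => d (A ω) = Y ω)]
    have e1 : ∑ ω with d (A ω) = Y ω, M / (2 * m ω) * ∏ i, (N ω i / c) =
        M / 2 * ∑ ω with d (A ω) = Y ω, ∏ i, (N ω i / c) := by
      rw [mul_sum]
      refine sum_congr rfl fun ω hω => ?_
      simp [m, (mem_filter.1 hω).2]
    have e2 : ∑ ω with ¬ d (A ω) = Y ω, M / (2 * m ω) * ∏ i, (N ω i / c) =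
        1 / 2 * ∑ ω with ¬ d (A ω) = Y ω, ∏ i, (N ω i / c) := by
      rw [mul_sum]
      refine sum_congr rfl fun ω hω => ?_
      simp only [m, ne_eq, (mem_filter.1 hω).2, not_false_iff, if_true]
      congr 1
      field_simp
    rw [e1, e2]
    calc _ ≤ M / 2 * (O / M) + 1 / 2 * O := by gcongr
      _ = O := by field_simp; ring

lemma count_mul_card {G H : Type*} [AddGroup G] [AddGroup H] [Fintype G] [Fintype H]
    (f : G →+ H) (hf : Function.Surjective f) (h : H) :
    count (fun g => f g = h) * Fintype.card H = Fintype.card G := by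
  rw [← card_univ (α := G), card_eq_sum_card_fiberwise (f := f) (t := univ)
    (fun _ _ => mem_coe.2 (mem_univ _)), sum_congr rfl fun h' _ =>
      AddMonoidHom.card_fiber_eq_of_mem_range f (hf h') (hf h)]
  simp [mul_comm, count]

end Counting

/-! ### Upper bound on achievable rates. -/

section Converse

open Finset Classical

lemma tsum_map_mul {α β : Type*} (μ : PMF α) (g : α → β) (f : β → ℝ≥0∞) :
    ∑' b, μ.map g b * f b = ∑' a, μ a * f (g a) := by
  simp only [PMF.map_apply, ← ENNReal.tsum_mul_right]
  rw [ENNReal.tsum_comm]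
  refine tsum_congr fun a => ?_
  rw [tsum_eq_single (g a) fun b hb => by simp [hb]]
  simp

lemma tsum_mul_le_of_forall_support {α : Type*} (μ : PMF α) {f g : α → ℝ≥0∞}
    (h : ∀ a ∈ μ.support, f a ≤ g a) : ∑' a, μ a * f a ≤ ∑' a, μ a * g a := by
  refine ENNReal.tsum_le_tsum fun a => ?_
  by_cases ha : μ a = 0
  · simp [ha]
  · gcongr
    exact h a ((PMF.mem_support_iff _ _).2 ha)

variable {p : ℕ} [Fact p.Prime] {F : ℕ} {S : Subfield (GaloisField p F)} {N K L Q : ℕ}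

/-- The request for the file `i`. -/
def unitIndex (S : Subfield (GaloisField p F)) (i : Fin K) : Index S K :=
  .mk S (Pi.single i 1) (by simp)

/-- The chosen representative of a projective point is only known up to a unit, whence the scalar
`a`. -/
lemma exists_target_unitIndex (i : Fin K) : ∃ a : GaloisField p F, a ≠ 0 ∧
    ∀ (w : Database p F K L) (t : Fin L), target (unitIndex S i) w t = a * w t i := by
  obtain ⟨a, ha⟩ := Projectivization.exists_smul_eq_mk_rep S (Pi.single i 1 : Fin K → S) (by simp)
  refine ⟨((a : S) : GaloisField p F), by simp, fun w t => ?_⟩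
  rw [target, sum_eq_single i]
  · rw [unitIndex, ← ha]; simp [Units.smul_def]
  · intro k _ hk
    rw [unitIndex, ← ha]; simp [hk]
  · simp

/-- The requested function of the database, as a homomorphism. -/
def targetHom (θ : Index S K) : Database p F K L →+ (Fin L → GaloisField p F) where
  toFun := target θ
  map_zero' := by funext t; simp [target]
  map_add' w w' := by funext t; simp [target, mul_add, sum_add_distrib]

@[simp]
lemma targetHom_apply (θ : Index S K) (w : Database p F K L) : targetHom θ w = target θ w := rfl

instance instFintypeGaloisField : Fintype (GaloisField p F) := Fintype.ofFinite _

lemma card_target_unitIndex (i : Fin K) (x : Fin L → GaloisField p F) :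
    count (fun w : Database p F K L => target (unitIndex S i) w = x) *
      Fintype.card (Fin L → GaloisField p F) = Fintype.card (Database p F K L) := by
  refine count_mul_card (targetHom (unitIndex S i)) (fun y => ?_) x
  obtain ⟨a, ha, h⟩ := exists_target_unitIndex (L := L) (S := S) i
  exact ⟨fun t _ => a⁻¹ * y t, funext fun t => by rw [targetHom_apply, h]; simp [ha]⟩

/-- Independence of two distinct files: the pair of targets is a surjective homomorphism, so its
fibers have equal size. -/
lemma card_target_unitIndex_and {i j : Fin K} (hij : i ≠ j) (x y : Fin L → GaloisField p F) :
    count (fun w : Database p F K L =>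
      target (unitIndex S i) w = x ∧ target (unitIndex S j) w = y) *
      Fintype.card (Fin L → GaloisField p F) =
    count fun w : Database p F K L => target (unitIndex S i) w = x := by
  have h := count_mul_card (G := Database p F K L)
    ((targetHom (unitIndex S i)).prod (targetHom (unitIndex S j))) (fun z => ?_) (x, y)
  · rw [Fintype.card_prod, ← mul_assoc, ← card_target_unitIndex i x] at h
    have := Nat.eq_of_mul_eq_mul_right Fintype.card_pos h
    rw [← this]
    congr 2
    funext w
    simp
  · obtain ⟨a, ha, h⟩ := exists_target_unitIndex (L := L) (S := S) i
    obtain ⟨b, hb, h'⟩ := exists_target_unitIndex (L := L) (S := S) j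
    let w : Database p F K L := fun t k => if k = i then a⁻¹ * z.1 t else b⁻¹ * z.2 t
    refine ⟨w, Prod.ext (funext fun t => (h w t).trans ?_) (funext fun t => (h' w t).trans ?_)⟩
    · simp [w, ha]
    · simp [w, hij.symm, hb]

lemma log_card_pi (hF : 1 ≤ F) :
    Real.log (Fintype.card (Fin L → GaloisField p F)) = L * (F * Real.log p) := by
  rw [Fintype.card_fun, Fintype.card_fin, ← Nat.card_eq_fintype_card (α := GaloisField p F),
    GaloisField.card p F (by lia)]
  push_cast
  rw [Real.log_pow, Real.log_pow]

/-! ### Entropy bounds for a single scheme. -/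

namespace Scheme

variable (s : Scheme p F S N K L Q)

/-- The number of databases for which the decoding fails, when the queries are `x`. -/
def errorCount (θ : Index S K) (x : Fin N → s.Query) : ℕ :=
  count fun w : Database p F K L => s.dec θ x (fun n => s.ans n (x n) w) ≠ target θ w

/-- The entropy of the answer of server `n` to the query `q`, conditioned on the value of the
request `θ`. -/
def condEntropy (θ : Index S K) (n : Fin N) (q : s.Query) : ℝ :=
  (∑ w : Database p F K L,
    Real.log ((count fun w' : Database p F K L => target θ w' = target θ w) /
      fiberCard (fun w => (s.ans n q w, target θ w)) w)) / Fintype.card (Database p F K L)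

lemma condEntropy_nonneg (θ : Index S K) (n : Fin N) (q : s.Query) :
    0 ≤ s.condEntropy θ n q := by
  refine div_nonneg (sum_nonneg fun w _ => Real.log_nonneg ?_) (Nat.cast_nonneg _)
  rw [one_le_div (Nat.cast_pos.2 (fiberCard_pos _ _))]
  exact Nat.cast_le.2 (fiberCard_prodMk_le _ _ _)

lemma exists_finset_forall_ans_mem (x : Fin N → s.Query) :
    ∃ T : Finset (Fin N → List (ZMod p)), #T ≤ p ^ ∑ n, s.ansLen n (x n) ∧
      ∀ w : Database p F K L, (fun n => s.ans n (x n) w) ∈ T := by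
  refine ⟨univ.image fun (v : ∀ n, List.Vector (ZMod p) (s.ansLen n (x n))) n => (v n).1,
    card_image_le.trans ?_, fun w => ?_⟩
  · simp [Fintype.card_pi, prod_pow_eq_pow_sum]
  · exact mem_image.2 ⟨fun n => ⟨s.ans n (x n) w, s.length_ans _ _ _⟩, mem_univ _, rfl⟩

/-- By the chain rule the left side is the joint entropy of the answer of server `n` and file `i`.
The lengths being fixed by `x`, there are at most `p ^ ∑ n, s.ansLen n (x n)` answer tuples. -/
lemma log_card_add_condEntropy_le (i : Fin K) (n : Fin N) (x : Fin N → s.Query) :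
    Real.log (Fintype.card (Fin L → GaloisField p F)) + s.condEntropy (unitIndex S i) n (x n) ≤
      Real.log 2 + (∑ n, s.ansLen n (x n) : ℕ) * Real.log p +
      s.errorCount (unitIndex S i) x / Fintype.card (Database p F K L) *
        Real.log (Fintype.card (Fin L → GaloisField p F)) := by
  obtain ⟨T, hTB, hT⟩ := s.exists_finset_forall_ans_mem x
  have key := sum_log_card_div_fiberCard_le (fun (w : Database p F K L) n => s.ans n (x n) w)
    (target (unitIndex S i)) (s.dec (unitIndex S i) x) _ T hT hTB n
  have hp : (p : ℝ) ≠ 0 := Nat.cast_ne_zero.2 (Fact.out : p.Prime).ne_zero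
  have hO : (0 : ℝ) < Fintype.card (Database p F K L) := Nat.cast_pos.2 Fintype.card_pos
  have hM : (0 : ℝ) < Fintype.card (Fin L → GaloisField p F) := Nat.cast_pos.2 Fintype.card_pos
  push_cast at key
  rw [Real.log_mul two_ne_zero (pow_ne_zero _ hp), Real.log_pow] at key
  have e : ∑ w : Database p F K L, Real.log ((Fintype.card (Database p F K L) : ℝ) /
      fiberCard (fun w => (s.ans n (x n) w, target (unitIndex S i) w)) w) =
      Fintype.card (Database p F K L) * (Real.log (Fintype.card (Fin L → GaloisField p F)) +
        s.condEntropy (unitIndex S i) n (x n)) := by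
    rw [mul_add, condEntropy, mul_div_cancel₀ _ hO.ne', ← nsmul_eq_mul,
      ← card_univ (α := Database p F K L), ← sum_const, ← sum_add_distrib]
    refine sum_congr rfl fun w _ => ?_
    have hf := fiberCard_pos (fun w => (s.ans n (x n) w, target (unitIndex S i) w)) w
    have hc := hf.trans_le (fiberCard_prodMk_le _ _ _)
    rw [← Real.log_mul hM.ne' (by positivity), card_univ,
      ← card_target_unitIndex i (target (unitIndex S i) w)]
    congr 1
    push_cast
    ring
  rw [e] at key
  rw [← mul_le_mul_iff_right₀ hO]
  refine key.trans (le_of_eq ?_)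
  simp only [errorCount]
  field_simp

lemma log_card_le_sum_condEntropy {i j : Fin K} (hij : i ≠ j) (x : Fin N → s.Query) :
    Real.log (Fintype.card (Fin L → GaloisField p F)) ≤
      Real.log 2 + s.errorCount (unitIndex S j) x / Fintype.card (Database p F K L) *
        Real.log (Fintype.card (Fin L → GaloisField p F)) +
      ∑ n, s.condEntropy (unitIndex S i) n (x n) := by
  have hO : (0 : ℝ) < Fintype.card (Database p F K L) := Nat.cast_pos.2 Fintype.card_pos
  have hc (y y' : Fin L → GaloisField p F) :
      (count fun w : Database p F K L => target (unitIndex S i) w = y) =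
        count fun w : Database p F K L => target (unitIndex S i) w = y' :=
    Nat.eq_of_mul_eq_mul_right Fintype.card_pos
      ((card_target_unitIndex i y).trans (card_target_unitIndex i y').symm)
  have key := card_mul_log_le_sum_sum_log_div_fiberCard
    (fun (w : Database p F K L) n => s.ans n (x n) w)
    (target (unitIndex S i)) (target (unitIndex S j)) (s.dec (unitIndex S j) x)
    _ (fun y => hc y 0) (fun y z => (card_target_unitIndex_and hij y z).le.trans (hc y 0).le)
  have e : ∑ w : Database p F K L, ∑ n, Real.log
      (((count fun w : Database p F K L => target (unitIndex S i) w = 0) : ℝ) /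
      fiberCard (fun w => (s.ans n (x n) w, target (unitIndex S i) w)) w) =
      Fintype.card (Database p F K L) * ∑ n, s.condEntropy (unitIndex S i) n (x n) := by
    rw [sum_comm, mul_sum]
    refine sum_congr rfl fun n _ => ?_
    rw [condEntropy, mul_div_cancel₀ _ hO.ne']
    exact sum_congr rfl fun w _ => by rw [hc 0 (target (unitIndex S i) w)]
  rw [e] at key
  rw [← mul_le_mul_iff_right₀ hO]
  refine key.trans (le_of_eq ?_)
  simp only [errorCount]
  field_simp

lemma tsum_errorCount_le (θ : Index S K) :
    ∑' x, s.queryLaw θ x *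
      ((s.errorCount θ x : ℝ≥0∞) / Fintype.card (Database p F K L)) ≤ s.errorProb := by
  refine le_trans (le_of_eq ?_) (le_iSup _ θ)
  rw [jointLaw, PMF.toOuterMeasure_bind_apply]
  refine tsum_congr fun x => ?_
  rw [PMF.toOuterMeasure_map_apply, PMF.toOuterMeasure_uniformOfFintype_apply, errorCount,
    count, Fintype.card_subtype]
  congr!

lemma map_queryLaw (n : Fin N) (θ θ' : Index S K) :
    (s.queryLaw θ).map (fun x => x n) = (s.queryLaw θ').map fun x => x n := by
  have h (θ) : (s.queryLaw θ).map (fun x => x n) = ((jointLaw (p := p) (F := F) (K := K) (L := L)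
      (s.queryLaw θ)).map fun z => (z.1 n, s.ans n (z.1 n) z.2, z.2)).map Prod.fst := by
    simp only [jointLaw, PMF.map_bind, PMF.map_comp]
    rw [← PMF.bind_pure_comp]
    congr 1
    funext x
    exact (PMF.map_const _ _).symm
  rw [h, h, s.privacy n θ θ']

/-- The average of `condEntropy` over the query of server `n`. -/
def meanCondEntropy (θ : Index S K) (n : Fin N) : ℝ≥0∞ :=
  ∑' q, (s.queryLaw θ).map (fun x => x n) q * ENNReal.ofReal (s.condEntropy θ n q)

/-- This is where privacy enters: `condEntropy θ n` sees only the query of server `n`, whose law is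
the same under `θ'`. -/
lemma tsum_condEntropy (θ θ' : Index S K) (n : Fin N) :
    ∑' x, s.queryLaw θ' x * ENNReal.ofReal (s.condEntropy θ n (x n)) = s.meanCondEntropy θ n := by
  rw [meanCondEntropy, s.map_queryLaw n θ θ', tsum_map_mul]

lemma ofReal_add_meanCondEntropy_le (i : Fin K) (n : Fin N) :
    ENNReal.ofReal (Real.log (Fintype.card (Fin L → GaloisField p F))) +
      s.meanCondEntropy (unitIndex S i) n ≤
    ENNReal.ofReal (Real.log 2 + (Q * F : ℕ) * Real.log p) +
      s.errorProb * ENNReal.ofReal (Real.log (Fintype.card (Fin L → GaloisField p F))) := by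
  set m := Real.log (Fintype.card (Fin L → GaloisField p F))
  have hm : 0 ≤ m := Real.log_natCast_nonneg _
  have hlp : 0 ≤ Real.log p := Real.log_natCast_nonneg _
  have hl2 : 0 ≤ Real.log 2 := Real.log_nonneg one_le_two
  have key := tsum_mul_le_of_forall_support (s.queryLaw (unitIndex S i))
    (f := fun x => ENNReal.ofReal m + ENNReal.ofReal (s.condEntropy (unitIndex S i) n (x n)))
    (g := fun x => ENNReal.ofReal (Real.log 2 + (Q * F : ℕ) * Real.log p) +
      (s.errorCount (unitIndex S i) x : ℝ≥0∞) / Fintype.card (Database p F K L) *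
        ENNReal.ofReal m) fun x hx => by
    have hD : ∑ n, s.ansLen n (x n) ≤ Q * F := s.cost.2 ⟨_, x, hx, rfl⟩
    have h := s.log_card_add_condEntropy_le i n x
    rw [← ENNReal.ofReal_natCast, ← ENNReal.ofReal_natCast,
      ← ENNReal.ofReal_div_of_pos (Nat.cast_pos.2 Fintype.card_pos),
      ← ENNReal.ofReal_mul (by positivity), ← ENNReal.ofReal_add hm (s.condEntropy_nonneg _ _ _),
      ← ENNReal.ofReal_add (by positivity) (by positivity)]
    refine ENNReal.ofReal_le_ofReal (h.trans ?_)
    gcongr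
  simp only [mul_add, ENNReal.tsum_add, ENNReal.tsum_mul_right, PMF.tsum_coe, one_mul,
    ← mul_assoc, tsum_condEntropy] at key
  exact key.trans (by gcongr; exact s.tsum_errorCount_le _)

lemma ofReal_le_sum_meanCondEntropy {i j : Fin K} (hij : i ≠ j) :
    ENNReal.ofReal (Real.log (Fintype.card (Fin L → GaloisField p F))) ≤
      ENNReal.ofReal (Real.log 2) +
      s.errorProb * ENNReal.ofReal (Real.log (Fintype.card (Fin L → GaloisField p F))) +
      ∑ n, s.meanCondEntropy (unitIndex S i) n := by
  set m := Real.log (Fintype.card (Fin L → GaloisField p F))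
  have hm : 0 ≤ m := Real.log_natCast_nonneg _
  have hl2 : 0 ≤ Real.log 2 := Real.log_nonneg one_le_two
  -- The queries follow the law for `j`, while the entropies are conditioned on file `i`.
  have key := tsum_mul_le_of_forall_support (s.queryLaw (unitIndex S j))
    (f := fun x => ENNReal.ofReal m)
    (g := fun x => ENNReal.ofReal (Real.log 2) +
      (s.errorCount (unitIndex S j) x : ℝ≥0∞) / Fintype.card (Database p F K L) *
        ENNReal.ofReal m + ∑ n, ENNReal.ofReal (s.condEntropy (unitIndex S i) n (x n)))
    fun x hx => by
    have h := s.log_card_le_sum_condEntropy hij x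
    have hs : 0 ≤ ∑ n, s.condEntropy (unitIndex S i) n (x n) :=
      sum_nonneg fun n _ => s.condEntropy_nonneg _ _ _
    rw [← ENNReal.ofReal_natCast, ← ENNReal.ofReal_natCast,
      ← ENNReal.ofReal_div_of_pos (Nat.cast_pos.2 Fintype.card_pos),
      ← ENNReal.ofReal_mul (by positivity),
      ← ENNReal.ofReal_sum_of_nonneg fun n _ => s.condEntropy_nonneg _ _ _,
      ← ENNReal.ofReal_add (by positivity) (by positivity),
      ← ENNReal.ofReal_add (by positivity) (by positivity)]
    exact ENNReal.ofReal_le_ofReal h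
  simp only [mul_add, mul_sum, ENNReal.tsum_add, ENNReal.tsum_mul_right, PMF.tsum_coe, one_mul,
    ← mul_assoc, Summable.tsum_finsetSum fun _ _ => ENNReal.summable, tsum_condEntropy] at key
  exact key.trans (by gcongr; exact s.tsum_errorCount_le _)

lemma toReal_meanCondEntropy_le (hF : 1 ≤ F) (he : s.errorProb ≠ ⊤) (i : Fin K) (n : Fin N) :
    s.meanCondEntropy (unitIndex S i) n ≠ ⊤ ∧
    (s.meanCondEntropy (unitIndex S i) n).toReal ≤
      (Q + 1 - (1 - s.errorProb.toReal) * L) * (F * Real.log p) := by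
  have key := s.ofReal_add_meanCondEntropy_le i n
  rw [log_card_pi hF] at key
  have hlp : 0 ≤ Real.log p := Real.log_natCast_nonneg _
  have hl2 : 0 ≤ Real.log 2 := Real.log_nonneg one_le_two
  have hr : ENNReal.ofReal (Real.log 2 + (Q * F : ℕ) * Real.log p) +
      s.errorProb * ENNReal.ofReal (L * (F * Real.log p)) ≠ ⊤ := by finiteness
  have hE : s.meanCondEntropy (unitIndex S i) n ≠ ⊤ := ne_top_of_le_ne_top hr (le_add_self.trans key)
  refine ⟨hE, ?_⟩
  have h := ENNReal.toReal_mono hr key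
  rw [ENNReal.toReal_add (by finiteness) hE, ENNReal.toReal_add (by finiteness) (by finiteness),
    ENNReal.toReal_mul, ENNReal.toReal_ofReal (by positivity), ENNReal.toReal_ofReal (by positivity)]
    at h
  -- The constant `log 2` of Fano's correction costs at most one symbol of `GF(p^F)`, hence the `+
  -- 1` after `Q`.
  have h2 : Real.log 2 ≤ F * Real.log p := by
    have h2p : Real.log 2 ≤ Real.log p :=
      Real.log_le_log two_pos (by exact_mod_cast (Fact.out : p.Prime).two_le)
    have : (1 : ℝ) ≤ F := by exact_mod_cast hF
    nlinarith
  push_cast at h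
  linarith

/-- The trivial converse bound. -/
lemma sub_one_le (hF : 1 ≤ F) (hN : 1 ≤ N) (hK : 1 ≤ K) (he : s.errorProb ≠ ⊤) :
    (1 - s.errorProb.toReal) * L - 1 ≤ Q := by
  have h := (s.toReal_meanCondEntropy_le hF he ⟨0, hK⟩ ⟨0, hN⟩).2
  have hlp : 0 < Real.log p := Real.log_pos (by exact_mod_cast (Fact.out : p.Prime).one_lt)
  have : 0 < F * Real.log p := by positivity
  have := nonneg_of_mul_nonneg_left (ENNReal.toReal_nonneg.trans h) this
  linarith

/-- The converse bound of private information retrieval with two files. -/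
lemma mul_sub_one_le (hF : 1 ≤ F) (hK : 2 ≤ K) (he : s.errorProb ≠ ⊤) :
    (N + 1 : ℝ) * ((1 - s.errorProb.toReal) * L - 1) ≤ N * Q := by
  have hij : (⟨0, by lia⟩ : Fin K) ≠ ⟨1, hK⟩ := by simp
  have key := s.ofReal_le_sum_meanCondEntropy hij
  have hE := s.toReal_meanCondEntropy_le hF he ⟨0, by lia⟩
  rw [log_card_pi hF] at key
  have hlp : 0 < Real.log p := Real.log_pos (by exact_mod_cast (Fact.out : p.Prime).one_lt)
  have hl2 : 0 ≤ Real.log 2 := Real.log_nonneg one_le_two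
  have hsum := ENNReal.sum_ne_top.2 fun n (_ : n ∈ univ) => (hE n).1
  have h := ENNReal.toReal_mono (by finiteness) key
  rw [ENNReal.toReal_add (by finiteness) hsum, ENNReal.toReal_add (by finiteness) (by finiteness),
    ENNReal.toReal_mul, ENNReal.toReal_ofReal (by positivity), ENNReal.toReal_ofReal (by positivity),
    ENNReal.toReal_sum fun n _ => (hE n).1] at h
  have h3 := sum_le_sum fun n (_ : n ∈ univ) => (hE n).2
  simp only [sum_const, card_univ, Fintype.card_fin, nsmul_eq_mul] at h3
  have h2 : Real.log 2 ≤ F * Real.log p := by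
    have h2p : Real.log 2 ≤ Real.log p :=
      Real.log_le_log two_pos (by exact_mod_cast (Fact.out : p.Prime).two_le)
    have : (1 : ℝ) ≤ F := by exact_mod_cast hF
    nlinarith
  have hpos : 0 < F * Real.log p := by positivity
  refine le_of_mul_le_mul_right ?_ hpos
  -- Up to the factor `F * log p`, `h` and `h3` combine to `(1 - e) L - 1 ≤ N (Q + 1 - (1 - e) L)`,
  -- where `e` is the error probability.
  nlinarith

end Scheme

/-! ### Passing from schemes to limiting rates. -/

lemma mul_le_of_achievable {a b R : ℝ} (hb : 0 ≤ b)
    (h : ∀ (L Q : ℕ) (s : Scheme p F S N K L Q), s.errorProb ≠ ⊤ →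
      a * ((1 - s.errorProb.toReal) * L - 1) ≤ b * Q) (hR : Achievable p F S N K R) :
    a * R ≤ b := by
  obtain ⟨L, Q, s, hL, hrate, herr⟩ := hR
  have hinv : Tendsto (fun j => ((L j : ℝ))⁻¹) atTop (𝓝 0) :=
    tendsto_inv_atTop_zero.comp (tendsto_natCast_atTop_atTop.comp hL)
  have herr' : Tendsto (fun j => (s j).errorProb.toReal) atTop (𝓝 0) :=
    (ENNReal.tendsto_toReal ENNReal.zero_ne_top).comp herr
  have hlim : Tendsto (fun j => a * (1 - (s j).errorProb.toReal - (L j : ℝ)⁻¹) *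
      ((L j : ℝ) / Q j)) atTop (𝓝 (a * (1 - 0 - 0) * R)) :=
    (((herr'.const_sub 1).sub hinv).const_mul a).mul hrate
  rw [sub_zero, sub_zero, mul_one] at hlim
  refine le_of_tendsto hlim ?_
  filter_upwards [herr.eventually_lt_const ENNReal.zero_lt_top, hL.eventually_ge_atTop 1] with j he hj
  have hj' : (0 : ℝ) < L j := by exact_mod_cast hj
  -- If `Q j = 0`, the rate is 0 by the convention for division, and `hb` suffices.
  rcases Nat.eq_zero_or_pos (Q j) with hQ | hQ
  · simpa [hQ] using hb
  have hQ' : (0 : ℝ) < Q j := by exact_mod_cast hQ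
  have := h _ _ (s j) he.ne
  rw [← mul_div_assoc, div_le_iff₀ hQ']
  refine le_trans (le_of_eq ?_) this
  field_simp

end Converse

/-! ### Constructions of error-free schemes. -/

section Achievability

variable {p : ℕ} [Fact p.Prime] {F : ℕ} {S : Subfield (GaloisField p F)} {N K L : ℕ}

lemma map_jointLaw {Query γ : Type} (μ : PMF (Fin N → Query))
    (g : (Fin N → Query) × Database p F K L → γ) :
    (jointLaw μ).map g =
      μ.bind fun x => (PMF.uniformOfFintype (Database p F K L)).map fun w => g (x, w) := by
  simp only [jointLaw, PMF.map_bind, PMF.map_comp]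
  rfl

/-- Queries whose marginals do not depend on the request, and from whose answers the request can
always be decoded, give a scheme without errors. -/
lemma exists_scheme_errorProb_eq_zero {Query β : Type} [Nonempty (Index S K)] [Finite β] {m : ℕ}
    (hβ : Nat.card β = p ^ (m * F)) (law : Index S K → PMF (Fin N → Query))
    (hlaw : ∀ n θ θ', (law θ).map (fun x => x n) = (law θ').map fun x => x n)
    (r : Fin N → Query → Database p F K L → β)
    (d : Index S K → (Fin N → Query) → (Fin N → β) → Fin L → GaloisField p F)
    (hd : ∀ θ, ∀ x ∈ (law θ).support, ∀ w, d θ x (fun n => r n (x n) w) = target θ w) :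
    ∃ s : Scheme p F S N K L (N * m), s.errorProb = 0 := by
  have := Fintype.ofFinite β
  let e : β ≃ List.Vector (ZMod p) (m * F) := Fintype.equivOfCardEq (by
    rw [card_vector, ZMod.card, ← hβ, Nat.card_eq_fintype_card])
  have : Nonempty β := ⟨e.symm (List.Vector.replicate _ 0)⟩
  let φ : List (ZMod p) → β := Function.invFun fun b => (e b).1
  have hφ : ∀ b, φ (e b).1 = b :=
    Function.leftInverse_invFun fun a b h => e.injective (Subtype.ext h)
  let s : Scheme p F S N K L (N * m) :=
    { Query := Query
      queryLaw := law
      ans := fun n q w => (e (r n q w)).1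
      ansLen := fun _ _ => m * F
      length_ans := fun n q w => (e (r n q w)).2
      dec := fun θ x a => d θ x fun n => φ (a n)
      cost := by
        constructor
        · obtain ⟨x, hx⟩ := (law (Classical.arbitrary _)).support_nonempty
          exact ⟨_, x, hx, by simp [mul_assoc]⟩
        · rintro _ ⟨θ, x, -, rfl⟩
          simp [mul_assoc]
      privacy := by
        -- The answer is a function of the query and of the independent database, so equality of the
        -- query marginals is enough.
        intro n θ θ'
        have h (θ) := PMF.bind_map (law θ) (fun x => x n) fun q =>
          (PMF.uniformOfFintype (Database p F K L)).map fun w => (q, (e (r n q w)).1, w)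
        rw [map_jointLaw, map_jointLaw]
        exact (h θ).symm.trans ((congrArg (fun μ : PMF Query => μ.bind _) (hlaw n θ θ')).trans
          (h θ')) }
  refine ⟨s, ?_⟩
  simp only [Scheme.errorProb, ENNReal.iSup_eq_zero]
  intro θ
  rw [PMF.toOuterMeasure_apply_eq_zero_iff, Set.disjoint_left]
  rintro ⟨x, w⟩ hz hne
  refine hne ?_
  have hx : x ∈ (law θ).support := by
    simp only [jointLaw, PMF.support_bind, PMF.support_map, Set.mem_iUnion, Set.mem_image,
      Prod.mk.injEq] at hz
    obtain ⟨y, hy, w', -, rfl, -⟩ := hz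
    exact hy
  simp only [s, hφ]
  exact hd θ x hx w

lemma nonempty_index (hK : 1 ≤ K) : Nonempty (Index S K) :=
  ⟨.mk S (Pi.single (⟨0, hK⟩ : Fin K) 1) (by simp)⟩

lemma achievable_of_forall_exists_scheme {m l : ℕ} (hl : 1 ≤ l)
    (h : ∀ j : ℕ, ∃ s : Scheme p F S N K (l * j) (m * j), s.errorProb = 0) :
    Achievable p F S N K (l / m) := by
  choose s hs using h
  -- The shift to `j + 1` makes the common factor nonzero, so that every rate is exactly `l / m`.
  refine ⟨fun j => l * (j + 1), fun j => m * (j + 1), fun j => s (j + 1), ?_, ?_, ?_⟩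
  · exact tendsto_atTop_mono (fun j => (Nat.le_succ j).trans (Nat.le_mul_of_pos_left _ hl)) tendsto_id
  · refine tendsto_const_nhds.congr fun j => ?_
    push_cast
    rw [mul_div_mul_right]
    positivity
  · simp [hs]

/-- Downloading the whole database from each server. -/
lemma achievable_one_div (hN : 1 ≤ N) (hK : 1 ≤ K) (hF : 1 ≤ F) :
    Achievable p F S N K (1 / (N * K)) := by
  have := nonempty_index (S := S) hK
  have key := achievable_of_forall_exists_scheme (p := p) (F := F) (S := S) (N := N) (K := K)
    (m := N * K) (l := 1) le_rfl fun j => ?_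
  · simpa using key
  rw [mul_assoc]
  refine exists_scheme_errorProb_eq_zero (Query := Unit) (β := Database p F K (1 * j)) ?_
    (fun _ => PMF.pure fun _ => ()) (fun _ _ _ => rfl) (fun _ _ w => w)
    (fun θ _ a => target θ (a ⟨0, hN⟩)) fun _ _ _ _ => rfl
  rw [Nat.card_fun, Nat.card_fun, GaloisField.card p F (by lia)]
  simp only [Nat.card_eq_fintype_card, Fintype.card_fin]
  ring

lemma map_uniformOfFintype_equiv {α β : Type*} [Fintype α] [Nonempty α] [Fintype β] [Nonempty β]
    (e : α ≃ β) : (PMF.uniformOfFintype α).map e = PMF.uniformOfFintype β := by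
  ext b
  rw [PMF.map_apply, tsum_eq_single (e.symm b)]
  · simp [Fintype.card_congr e]
  · intro a ha
    rw [if_neg]
    rintro rfl
    simp at ha

/-- The scheme in which one server receives random coefficients, and each other server receives
the same ones, with the requested coefficients added in a block of its own. -/
lemma achievable_sub_one_div (hK : 1 ≤ K) (hF : 1 ≤ F) {N' : ℕ} (hN : 1 ≤ N') :
    Achievable p F S (N' + 1) K (N' / (N' + 1 : ℕ)) := by
  have := nonempty_index (S := S) hK
  have : Finite S := inferInstance
  have := Fintype.ofFinite S
  refine achievable_of_forall_exists_scheme hN fun j => ?_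
  let shift (θ : Index S K) : Fin (N' + 1) → Fin N' → Fin K → S :=
    Fin.cons 0 fun i => Pi.single i θ.rep
  refine exists_scheme_errorProb_eq_zero (Query := Fin N' → Fin K → S)
    (β := Fin j → GaloisField p F) ?_
    (fun θ => (PMF.uniformOfFintype (Fin N' → Fin K → S)).map fun z n => z + shift θ n) ?_
    -- The `N' * j` segments are cut into `N'` blocks of length `j`; each answer sums one
    -- combination per block and so has only `j` symbols.
    (fun _ q w t => ∑ i, ∑ k, (q i k : GaloisField p F) * w (finProdFinEquiv (i, t)) k)
    (fun _ _ a t => a (finProdFinEquiv.symm t).1.succ (finProdFinEquiv.symm t).2 -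
      a 0 (finProdFinEquiv.symm t).2) ?_
  · rw [Nat.card_fun, GaloisField.card p F (by lia)]
    simp only [Nat.card_eq_fintype_card, Fintype.card_fin]
    ring
  · have h (n) (θ : Index S K) : ((PMF.uniformOfFintype (Fin N' → Fin K → S)).map
        fun z n => z + shift θ n).map (fun x => x n) = PMF.uniformOfFintype _ := by
      rw [PMF.map_comp]
      exact map_uniformOfFintype_equiv (Equiv.addRight (shift θ n))
    intro n θ θ'
    rw [h, h]
  · intro θ x hx w
    rw [PMF.mem_support_map_iff] at hx
    obtain ⟨z, -, rfl⟩ := hx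
    funext t
    obtain ⟨⟨i, u⟩, rfl⟩ := finProdFinEquiv.surjective t
    simp only [Equiv.symm_apply_apply, shift, Fin.cons_succ, Fin.cons_zero, add_zero, target]
    rw [← Finset.sum_sub_distrib, Finset.sum_eq_single i]
    · rw [← Finset.sum_sub_distrib]
      refine Finset.sum_congr rfl fun k _ => ?_
      simp [add_mul]
    · intro i' _ hi
      simp [Pi.single_eq_of_ne hi]
    · simp

end Achievability

/-! ### Bounds on the capacity. -/

section Capacity

variable {p : ℕ} [Fact p.Prime] {F : ℕ} {S : Subfield (GaloisField p F)} {N K : ℕ} {R : ℝ}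

lemma le_one_of_achievable (hF : 1 ≤ F) (hN : 1 ≤ N) (hK : 1 ≤ K) (hR : Achievable p F S N K R) :
    R ≤ 1 := by
  simpa using mul_le_of_achievable (a := 1) zero_le_one
    (fun L Q s he => by simpa using s.sub_one_le hF hN hK he) hR

lemma add_one_mul_le_of_achievable (hF : 1 ≤ F) (hK : 2 ≤ K) (hR : Achievable p F S N K R) :
    (N + 1 : ℝ) * R ≤ N :=
  mul_le_of_achievable N.cast_nonneg (fun _ _ s he => s.mul_sub_one_le hF hK he) hR

lemma isLUB_capacity (hF : 1 ≤ F) (hN : 1 ≤ N) (hK : 1 ≤ K) :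
    IsLUB {R : ℝ | Achievable p F S N K R} (capacity p F S N K) :=
  isLUB_csSup ⟨_, achievable_one_div hN hK hF⟩ ⟨1, fun _ => le_one_of_achievable hF hN hK⟩

lemma one_sub_one_div_le_capacity (hF : 1 ≤ F) (hN : 2 ≤ N) (hK : 1 ≤ K) :
    1 - 1 / (N : ℝ) ≤ capacity p F S N K := by
  obtain ⟨n, rfl⟩ : ∃ n, N = n + 1 := ⟨N - 1, by lia⟩
  refine le_trans (le_of_eq ?_) ((isLUB_capacity hF (by lia) hK).1
    (achievable_sub_one_div (S := S) hK hF (show 1 ≤ n by lia)))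
  push_cast
  have : (n + 1 : ℝ) ≠ 0 := by positivity
  field_simp
  ring

end Capacity

end PFR

end

theorem corollary1 (K : ℕ) (hK : 1 ≤ K) :
    -- the capacity is a genuine supremum, of a nonempty and bounded set of rates
    (∀ N : ℕ, 1 ≤ N → ∀ (p : ℕ) [Fact p.Prime] (F : ℕ), 1 ≤ F →
      ∀ S : Subfield (GaloisField p F),
        IsLUB {R : ℝ | PFR.Achievable p F S N K R} (PFR.capacity p F S N K)) ∧
    -- the capacity is asymptotically equivalent to `1 - 1 / N`, uniformly in the fields
    (∀ ε : ℝ, 0 < ε → ∃ N₀ : ℕ, ∀ N : ℕ, N₀ ≤ N →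
      ∀ (p : ℕ) [Fact p.Prime] (F : ℕ), 1 ≤ F → ∀ S : Subfield (GaloisField p F),
        |PFR.capacity p F S N K / (1 - 1 / (N : ℝ)) - 1| ≤ ε) ∧
    -- with at least two messages it is `1 - 1 / N + o(1 / N)`, uniformly in the fields
    (2 ≤ K → ∀ ε : ℝ, 0 < ε → ∃ N₀ : ℕ, ∀ N : ℕ, N₀ ≤ N →
      ∀ (p : ℕ) [Fact p.Prime] (F : ℕ), 1 ≤ F → ∀ S : Subfield (GaloisField p F),
        |PFR.capacity p F S N K - (1 - 1 / (N : ℝ))| ≤ ε / (N : ℝ)) := by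
  refine ⟨fun N hN p _ F hF S => PFR.isLUB_capacity hF hN hK, fun ε hε => ?_, fun hK2 ε hε => ?_⟩
  · obtain ⟨n, hn⟩ := exists_nat_gt (1 / ε)
    -- `N ≥ n + 2` gives `N ≥ 2`, as the lower bound requires, and `ε * (N - 1) ≥ 1`, which is what
    -- the bound `1 ≤ (ε + 1) * (1 - 1/N)` needs.
    refine ⟨n + 2, fun N hN p _ F hF S => ?_⟩
    have hle := PFR.one_sub_one_div_le_capacity (S := S) hF (show 2 ≤ N by lia) hK
    have hge : PFR.capacity p F S N K ≤ 1 := (PFR.isLUB_capacity hF (by lia) hK).2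
      fun _ => PFR.le_one_of_achievable hF (by lia) hK
    have hN' : (n + 2 : ℝ) ≤ N := by exact_mod_cast hN
    have hN0 : (0 : ℝ) < N := by linarith [n.cast_nonneg (α := ℝ)]
    have hd : 0 < 1 - 1 / (N : ℝ) := by
      rw [sub_pos, div_lt_one hN0]; linarith [n.cast_nonneg (α := ℝ)]
    rw [abs_of_nonneg (sub_nonneg.2 ((one_le_div hd).2 hle)), sub_le_iff_le_add, div_le_iff₀ hd]
    refine hge.trans ?_
    rw [div_lt_iff₀ hε] at hn
    have : (ε + 1) * (1 - 1 / (N : ℝ)) = 1 + (ε * (N - 1) - 1) / N := by field_simp; ring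
    rw [this, le_add_iff_nonneg_right]
    exact div_nonneg (by nlinarith) hN0.le
  · obtain ⟨n, hn⟩ := exists_nat_gt (1 / ε)
    refine ⟨n + 2, fun N hN p _ F hF S => ?_⟩
    have hle := PFR.one_sub_one_div_le_capacity (S := S) hF (show 2 ≤ N by lia) hK
    have hN' : (n + 2 : ℝ) ≤ N := by exact_mod_cast hN
    have hN0 : (0 : ℝ) < N := by linarith [n.cast_nonneg (α := ℝ)]
    have hge : PFR.capacity p F S N K ≤ N / (N + 1) :=
      (PFR.isLUB_capacity hF (by lia) hK).2 fun R hR => by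
        rw [le_div_iff₀ (by positivity), mul_comm]
        exact PFR.add_one_mul_le_of_achievable hF hK2 hR
    rw [abs_of_nonneg (sub_nonneg.2 hle)]
    rw [div_lt_iff₀ hε] at hn
    refine (sub_le_sub_right hge _).trans ?_
    have : (N : ℝ) / (N + 1) - (1 - 1 / N) = 1 / (N + 1) / N := by field_simp; ring
    rw [this]
    gcongr
    rw [div_le_iff₀ (by positivity)]
    nlinarith
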